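/- Let $k_1,u_0,u_1,q\in\mathbb C^\star$ with $q^m\neq 1$ for all $m\in\mathbb Z_{>0}$, and fix a square root $q^{1/2}$ of $q$. Let $\mathcal H_V$ be the unital associative $\mathbb C$-algebra generated by $V_0,V_1,\check V_0,\check V_1$ with the relations $$V_0^2+V_0=0,\qquad (V_1-k_1)(V_1+k_1^{-1})=0,\qquad \check V_0^2+u_0^{-1}\check V_0=0,\qquad (\check V_1-u_1)(\check V_1+u_1^{-1})=0,$$ $$q^{1/2}\check V_1V_1V_0=\check V_0+u_0^{-1},\qquad q^{1/2}\check V_0\check V_1V_1=V_0+1.$$ Let $S_1,S_2,S_3$ be quantum variables with $[S_1,S_2]=[S_2,S_3]=[S_3,S_1]=i\pi\hbar$, where $q=e^{-i\pi\hbar}$ and $q^{1/2}=e^{-i\pi\hbar/2}$, and with $u_0=-i\,e^{-S_1-S_2-S_3}$. Let the quantum torus $\mathbb T_q$ be the $\mathbb C$-algebra generated by the exponentials $e^{S}$, $S\in\mathbb ZS_1+\mathbb ZS_2+\mathbb ZS_3$. That is, $\mathbb T_q$ is the unital associative algebra on these generators with the relations $e^0=1$, $e^{S}e^{S'}=e^{\frac12[S,S']}e^{S+S'}$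 (where $e^{\frac12 i\pi\hbar}=q^{-1/2}$), and $-i\,e^{-S_1-S_2-S_3}=u_0$. Then the map $$V_0\mapsto\begin{pmatrix}-1&0\\ 1+i e^{S_3}&0\end{pmatrix},\qquad V_1\mapsto\begin{pmatrix}k_1-k_1^{-1}-i e^{S_2}&k_1-k_1^{-1}-i e^{-S_2}-i e^{S_2}\\ i e^{S_2}&i e^{S_2}\end{pmatrix},$$ $$\check V_1\mapsto\begin{pmatrix}0&-i e^{S_1}\\ i e^{-S_1}&u_1-u_1^{-1}\end{pmatrix},\qquad \check V_0\mapsto\begin{pmatrix}0&0\\ q^{1/2}s&-u_0^{-1}\end{pmatrix},$$ where $$s=e^{-S_1}e^{-S_2}+(k_1^{-1}-k_1)e^{-S_1}e^{S_3}+(u_1^{-1}-u_1)e^{S_2}e^{S_3}+i\,e^{-S_1}e^{-S_2}e^{S_3}+i\,e^{-S_1}e^{S_2}e^{S_3},$$ extends to an injective homomorphism of unital $\mathbb C$-algebras $\mathcal H_V\to \mathrm{Mat}(2,\mathbb T_q)$. In particular the four matrices satisfy the six defining relations of $\mathcal H_V$. The images of $V_0$ and $\check V_0$ are not invertible in $\mathrm{Mat}(2,\mathbb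 T_q)$. -/

import Mathlib

noncomputable section

/-- The four generators `V₀, V₁, V̌₀, V̌₁` of the confluent Cherednik algebra `H_V`. -/
inductive HVGen : Type
  | v0 | v1 | cv0 | cv1

/-- The six defining relations of `H_V`, for arbitrary elements of a complex algebra.
The number `r` plays the role of `q^{1/2}`. -/
structure SatisfiesHV {R : Type*} [Ring R] [Algebra ℂ R] (r k₁ u₀ u₁ : ℂ)
    (V₀ V₁ cV₀ cV₁ : R) : Prop where
  rel1 : V₀ ^ 2 + V₀ = 0
  rel2 : (V₁ - algebraMap ℂ R k₁) * (V₁ + algebraMap ℂ R k₁⁻¹) = 0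
  rel3 : cV₀ ^ 2 + u₀⁻¹ • cV₀ = 0
  rel4 : (cV₁ - algebraMap ℂ R u₁) * (cV₁ + algebraMap ℂ R u₁⁻¹) = 0
  rel5 : r • (cV₁ * V₁ * V₀) = cV₀ + algebraMap ℂ R u₀⁻¹
  rel6 : r • (cV₀ * cV₁ * V₁) = V₀ + 1

open FreeAlgebra HVGen in
/-- The same six relations, imposed on the free algebra on `V₀, V₁, V̌₀, V̌₁`. -/
inductive HVRel (r k₁ u₀ u₁ : ℂ) : FreeAlgebra ℂ HVGen → FreeAlgebra ℂ HVGen → Prop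
  | rel1 : HVRel r k₁ u₀ u₁ (ι ℂ v0 ^ 2 + ι ℂ v0) 0
  | rel2 : HVRel r k₁ u₀ u₁
      ((ι ℂ v1 - algebraMap ℂ _ k₁) * (ι ℂ v1 + algebraMap ℂ _ k₁⁻¹)) 0
  | rel3 : HVRel r k₁ u₀ u₁ (ι ℂ cv0 ^ 2 + u₀⁻¹ • ι ℂ cv0) 0
  | rel4 : HVRel r k₁ u₀ u₁
      ((ι ℂ cv1 - algebraMap ℂ _ u₁) * (ι ℂ cv1 + algebraMap ℂ _ u₁⁻¹)) 0
  | rel5 : HVRel r k₁ u₀ u₁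
      (r • (ι ℂ cv1 * ι ℂ v1 * ι ℂ v0)) (ι ℂ cv0 + algebraMap ℂ _ u₀⁻¹)
  | rel6 : HVRel r k₁ u₀ u₁ (r • (ι ℂ cv0 * ι ℂ cv1 * ι ℂ v1)) (ι ℂ v0 + 1)

/-- The confluent Cherednik algebra `H_V`: the complex unital associative algebra with generators
`V₀, V₁, V̌₀, V̌₁` and the six relations `HVRel`. -/
abbrev HV (r k₁ u₀ u₁ : ℂ) : Type := RingQuot (HVRel r k₁ u₀ u₁)

/-- The generators of `H_V`, as elements of `H_V`. -/
def HV.gen (r k₁ u₀ u₁ : ℂ) (g : HVGen) : HV r k₁ u₀ u₁ :=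
  RingQuot.mkAlgHom ℂ (HVRel r k₁ u₀ u₁) (FreeAlgebra.ι ℂ g)

/-- The commutator form on exponents: with `[S₁,S₂] = [S₂,S₃] = [S₃,S₁] = iπħ` one has
`[m₁S₁+m₂S₂+m₃S₃, n₁S₁+n₂S₂+n₃S₃] = iπħ · torusForm m n`. -/
def torusForm (m n : Fin 3 → ℤ) : ℤ :=
  (m 0 * n 1 - m 1 * n 0) + (m 1 * n 2 - m 2 * n 1) + (m 2 * n 0 - m 0 * n 2)

open FreeAlgebra in
/-- Relations between the exponentials `e^S`, `S = m₁S₁ + m₂S₂ + m₃S₃`: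
`e^0 = 1`, the rule `e^S e^{S'} = e^{[S,S']/2} e^{S+S'}` (where `e^{iπħ/2} = q^{-1/2} = r⁻¹`), and
`u₀ = -i e^{-S₁-S₂-S₃}`. -/
inductive TorusRel (r u₀ : ℂ) :
    FreeAlgebra ℂ (Fin 3 → ℤ) → FreeAlgebra ℂ (Fin 3 → ℤ) → Prop
  | zero : TorusRel r u₀ (ι ℂ 0) 1
  | mul (m n : Fin 3 → ℤ) : TorusRel r u₀ (ι ℂ m * ι ℂ n) (r ^ (-torusForm m n) • ι ℂ (m + n))
  | casimir : TorusRel r u₀ (-(Complex.I • ι ℂ ![-1, -1, -1])) (algebraMap ℂ _ u₀)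

/-- The quantum torus `T_q`, `q = r ^ 2`: the complex algebra generated by the exponentials of the
integer combinations of the quantum variables `S₁, S₂, S₃`. -/
abbrev QTorus (r u₀ : ℂ) : Type := RingQuot (TorusRel r u₀)

/-- The exponential `e^{aS₁+bS₂+cS₃}` in the quantum torus. -/
def qexp (r u₀ : ℂ) (a b c : ℤ) : QTorus r u₀ :=
  RingQuot.mkAlgHom ℂ (TorusRel r u₀) (FreeAlgebra.ι ℂ ![a, b, c])

/-- `e^{a S₁}` -/
abbrev expS₁ (r u₀ : ℂ) (a : ℤ) : QTorus r u₀ := qexp r u₀ a 0 0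
/-- `e^{a S₂}` -/
abbrev expS₂ (r u₀ : ℂ) (a : ℤ) : QTorus r u₀ := qexp r u₀ 0 a 0
/-- `e^{a S₃}` -/
abbrev expS₃ (r u₀ : ℂ) (a : ℤ) : QTorus r u₀ := qexp r u₀ 0 0 a

open Complex in
/-- The image of `V₀`. -/
def matV₀ (r u₀ : ℂ) : Matrix (Fin 2) (Fin 2) (QTorus r u₀) :=
  !![-1, 0;
     1 + I • expS₃ r u₀ 1, 0]

open Complex in
/-- The image of `V₁`. -/
def matV₁ (r k₁ u₀ : ℂ) : Matrix (Fin 2) (Fin 2) (QTorus r u₀) :=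
  !![algebraMap ℂ _ (k₁ - k₁⁻¹) - I • expS₂ r u₀ 1,
       algebraMap ℂ _ (k₁ - k₁⁻¹) - I • expS₂ r u₀ (-1) - I • expS₂ r u₀ 1;
     I • expS₂ r u₀ 1, I • expS₂ r u₀ 1]

open Complex in
/-- The image of `V̌₁`. -/
def matCV₁ (r u₀ u₁ : ℂ) : Matrix (Fin 2) (Fin 2) (QTorus r u₀) :=
  !![0, -(I • expS₁ r u₀ 1);
     I • expS₁ r u₀ (-1), algebraMap ℂ _ (u₁ - u₁⁻¹)]

open Complex in
/-- The element `s`. Its terms are ordered products of the exponentials of `S₁, S₂, S₃`,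
in the order in which they appear in matrix products. -/
def torusS (r k₁ u₀ u₁ : ℂ) : QTorus r u₀ :=
  expS₁ r u₀ (-1) * expS₂ r u₀ (-1)
    + (k₁⁻¹ - k₁) • (expS₁ r u₀ (-1) * expS₃ r u₀ 1)
    + (u₁⁻¹ - u₁) • (expS₂ r u₀ 1 * expS₃ r u₀ 1)
    + I • (expS₁ r u₀ (-1) * expS₂ r u₀ (-1) * expS₃ r u₀ 1)
    + I • (expS₁ r u₀ (-1) * expS₂ r u₀ 1 * expS₃ r u₀ 1)

/-- The image of `V̌₀`. -/
def matCV₀ (r k₁ u₀ u₁ : ℂ) : Matrix (Fin 2) (Fin 2) (QTorus r u₀) :=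
  !![0, 0;
     r • torusS r k₁ u₀ u₁, -algebraMap ℂ _ u₀⁻¹]

end

/-!
The six relations hold by direct computation in the quantum torus; the matrices of `V₀` and `V̌₀`
have a zero column and a zero row, and the quantum torus is nonzero because it acts on functions on
`ℤ × ℤ`, so they are not invertible. The substance is injectivity.

Put `W = V̌₁ V₁`, which is a unit. The defining relations turn into a presentation by `W^{±1}`, `V₁`
and the idempotent `-V₀`, in which `V₁` and `-V₀` behave like Demazure–Lusztig operators: moved past
a Laurent polynomial `f(W)` they act on `f` by the reflections `X ↦ X⁻¹` and `X ↦ q⁻¹ X⁻¹`, up to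
correction terms (`IsDemazureLetter`). Consequently the alternating words in `V₁` and `-V₀` span
`H_V` over `ℂ[W, W⁻¹]` (`mem_laurentSpan_dihedralWord`).

It remains to show that the images of these words are independent over `ℂ[W, W⁻¹]`. This needs no
leading terms of matrices, only that the image of `W` is transcendental. The commutators `[V₁, W]`
and `[-V₀, W]` implement the two reflections exactly, and their squares are nonzero Laurent
polynomials in `W`; so the alternating words in them are eigenvectors of right multiplication by
`W`, free of `ℂ[W, W⁻¹]`-torsion. Since `q` is not a root of unity, the eigenvalues `q^j X` and
`q^j X⁻¹` are distinct and these words are independent. Those of length at most `n` lie in the span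
of the equally many words of length at most `n` in `V₁` and `-V₀`, which are therefore independent
too (`linearIndependent_dihedralWord`).

Transcendence of the matrix `W` follows from a weight estimate in the representation of the quantum
torus on functions on `ℤ × ℤ` (`eq_zero_of_aeval_mul_eq_zero`).
-/

/-! ### Linear algebra over a commutative domain -/

/-- Eigenvectors for distinct eigenvalues are linearly independent over a commutative domain; the
ambient module may have torsion, as long as no eigenvector is a torsion element. -/
theorem linearIndependent_of_eigenvectors {ι L M : Type*} [CommRing L] [IsDomain L]
    [AddCommGroup M] [Module L M] (ρ : M →ₗ[L] M) (s : ι → M) (χ : ι → L)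
    (hχ : Function.Injective χ) (hs : ∀ i, ρ (s i) = χ i • s i)
    (hfree : ∀ i (f : L), f • s i = 0 → f = 0) : LinearIndependent L s := by
  classical
  rw [linearIndependent_iff']
  intro F
  induction F using Finset.induction_on with
  | empty => simp
  | insert j F hj ih =>
    intro f hf
    rw [Finset.sum_insert hj] at hf
    have hρ := congrArg ρ hf
    simp only [map_add, map_sum, map_smul, hs, map_zero] at hρ
    have hsub : ∑ i ∈ F, (f i * (χ i - χ j)) • s i = 0 := by
      have hj' := congrArg (fun x => χ j • x) hf
      simp only [smul_add, Finset.smul_sum, smul_zero] at hj'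
      rw [← sub_eq_zero.2 (hρ.trans hj'.symm), smul_comm (f j) (χ j) (s j), add_sub_add_left_eq_sub,
        ← Finset.sum_sub_distrib]
      refine Finset.sum_congr rfl fun i _ => ?_
      rw [smul_smul, smul_smul, ← sub_smul]
      ring_nf
    have hF : ∀ i ∈ F, f i = 0 := fun i hi => by
      rcases mul_eq_zero.1 (ih _ hsub i hi) with h | h
      · exact h
      · exact absurd (hχ (sub_eq_zero.1 h)) fun h => hj (h ▸ hi)
    have hfj : f j = 0 := by
      rw [Finset.sum_eq_zero fun i hi => by rw [hF i hi, zero_smul], add_zero] at hf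
      exact hfree j _ hf
    intro i hi
    rcases Finset.mem_insert.1 hi with rfl | hi
    exacts [hfj, hF i hi]

/-- If the span of a finite family contains an independent family with the same index set, then the
family is itself independent: a relation would be one vector too many in `L ^ ι`. -/
theorem LinearIndependent.of_mem_span {ι L M : Type*} [Fintype ι] [CommRing L] [IsDomain L]
    [AddCommGroup M] [Module L M] {s u : ι → M} (hs : LinearIndependent L s)
    (hsu : ∀ i, s i ∈ Submodule.span L (Set.range u)) : LinearIndependent L u := by
  classical
  have hlift : ∀ i, ∃ v : ι → L, Fintype.linearCombination L u v = s i := fun i => by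
    simpa [← Fintype.range_linearCombination] using hsu i
  choose v hv using hlift
  rw [Fintype.linearIndependent_iff]
  intro f hf
  by_contra! hne
  obtain ⟨i₀, hi₀⟩ := hne
  have hind : LinearIndependent L (fun o : Option ι => o.elim f v) := by
    rw [Fintype.linearIndependent_iff]
    intro c hc
    rw [Fintype.sum_option] at hc
    simp only [Option.elim_none, Option.elim_some] at hc
    have hπ := congrArg (Fintype.linearCombination L u) hc
    rw [map_add, map_sum, map_smul, map_zero, Fintype.linearCombination_apply L u f, hf, smul_zero,
      zero_add] at hπ
    simp only [map_smul, hv] at hπ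
    have hsome := Fintype.linearIndependent_iff.1 hs _ hπ
    simp only [hsome, zero_smul, Finset.sum_const_zero, add_zero] at hc
    have h0 : c none * f i₀ = 0 := congrFun hc i₀
    rintro (_ | i)
    · exact (mul_eq_zero.1 h0).resolve_right hi₀
    · exact hsome i
  have := hind.fintype_card_le_finrank
  simp at this

/-! ### Laurent polynomials in a unit of an algebra -/


section Laurent

open LaurentPolynomial

variable {K : Type*} [Field K] {R : Type*} [Ring R] [Algebra K R]

/-- Evaluation of Laurent polynomials at a unit `W` of a not necessarily commutative algebra. -/
noncomputable def laurentEval (W : Rˣ) : K[T;T⁻¹] →ₐ[K] R :=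
  AddMonoidAlgebra.lift K R ℤ ((Units.coeHom R).comp (zpowersHom Rˣ W))

theorem laurentEval_T (W : Rˣ) (n : ℤ) : laurentEval W (T n : K[T;T⁻¹]) = ↑(W ^ n) := by
  rw [laurentEval, T, AddMonoidAlgebra.lift_single]
  simp [zpowersHom_apply]

theorem laurentEval_T_one (W : Rˣ) : laurentEval W (T 1 : K[T;T⁻¹]) = W := by
  simp [laurentEval_T]

theorem laurentEval_T_neg_one (W : Rˣ) : laurentEval W (T (-1) : K[T;T⁻¹]) = ↑W⁻¹ := by
  simp [laurentEval_T]

theorem laurentEval_C (W : Rˣ) (c : K) : laurentEval W (C c) = algebraMap K R c := by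
  rw [C_eq_algebraMap, AlgHom.commutes]

theorem laurentEval_comm (W : Rˣ) (f g : K[T;T⁻¹]) :
    laurentEval W f * laurentEval W g = laurentEval W g * laurentEval W f := by
  rw [← map_mul, ← map_mul, mul_comm]

theorem laurent_subalgebra_eq_top (P : Subalgebra K K[T;T⁻¹]) (h₁ : T 1 ∈ P) (h₂ : T (-1) ∈ P) :
    P = ⊤ := by
  refine eq_top_iff.2 fun f _ => ?_
  have hT : ∀ n : ℤ, (T n : K[T;T⁻¹]) ∈ P := by
    rintro (n | n)
    · simpa [T_pow] using P.pow_mem h₁ n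
    · have := P.pow_mem h₂ (n + 1)
      rw [T_pow] at this
      convert this using 2
      rw [Int.negSucc_eq]
      push_cast
      ring
  induction f using LaurentPolynomial.induction_on' with
  | add p q hp hq => exact P.add_mem (hp trivial) (hq trivial)
  | C_mul_T n a => exact P.mul_mem (by rw [C_eq_algebraMap]; exact P.algebraMap_mem a) (hT n)

theorem map_laurentEval {R' : Type*} [Ring R'] [Algebra K R'] (φ : R →ₐ[K] R') (W : Rˣ)
    (f : K[T;T⁻¹]) : φ (laurentEval W f) = laurentEval (Units.map (φ : R →* R') W) f := by
  have := laurent_subalgebra_eq_top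
    (AlgHom.equalizer (φ.comp (laurentEval W)) (laurentEval (Units.map (φ : R →* R') W)))
    (by simp [AlgHom.mem_equalizer, laurentEval_T_one])
    (by simp [AlgHom.mem_equalizer, laurentEval_T_neg_one])
  have hf : f ∈ AlgHom.equalizer (φ.comp (laurentEval W))
      (laurentEval (Units.map (φ : R →* R') W)) := this ▸ trivial
  exact hf

theorem LaurentPolynomial.coeff_C_mul_T (c : K) (n m : ℤ) :
    (C c * T n).coeff m = if n = m then c else 0 := by
  rw [← single_eq_C_mul_T]
  exact Finsupp.single_apply

theorem LaurentPolynomial.C_mul_T_injective {c c' : K} {m n : ℤ} (hc : c ≠ 0)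
    (h : C c * T m = C c' * T n) : m = n ∧ c = c' := by
  have h1 := congrArg (fun f => f.coeff m) h
  simp only [coeff_C_mul_T, if_true] at h1
  by_cases hmn : n = m
  · exact ⟨hmn.symm, by simpa [hmn] using h1⟩
  · exact absurd (by simpa [hmn] using h1) hc

/-- The involution `X ↦ t X⁻¹` of Laurent polynomials. -/
noncomputable def laurentReflection (t : Kˣ) : K[T;T⁻¹] →ₐ[K] K[T;T⁻¹] :=
  laurentEval ⟨C (t : K) * T (-1), C (↑t⁻¹ : K) * T 1,
    by rw [mul_mul_mul_comm, ← map_mul, ← T_add]; simp,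
    by rw [mul_mul_mul_comm, ← map_mul, ← T_add]; simp⟩

theorem laurentReflection_C (t : Kˣ) (c : K) : laurentReflection t (C c) = C c := by
  rw [laurentReflection, laurentEval_C, C_eq_algebraMap]

theorem laurentReflection_T_one (t : Kˣ) : laurentReflection t (T 1) = C (t : K) * T (-1) :=
  laurentEval_T_one _

theorem laurentReflection_T_neg_one (t : Kˣ) :
    laurentReflection t (T (-1)) = C (↑t⁻¹ : K) * T 1 :=
  laurentEval_T_neg_one _

theorem laurentReflection_C_mul_T_one (t : Kˣ) (c : K) :
    laurentReflection t (C c * T 1) = C (c * t) * T (-1) := by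
  rw [map_mul, laurentReflection_C, laurentReflection_T_one, ← mul_assoc, ← map_mul]

theorem laurentReflection_C_mul_T_neg_one (t : Kˣ) (c : K) :
    laurentReflection t (C c * T (-1)) = C (c * ↑t⁻¹) * T 1 := by
  rw [map_mul, laurentReflection_C, laurentReflection_T_neg_one, ← mul_assoc, ← map_mul]

theorem laurentReflection_laurentReflection (t : Kˣ) (f : K[T;T⁻¹]) :
    laurentReflection t (laurentReflection t f) = f := by
  have := laurent_subalgebra_eq_top
    (AlgHom.equalizer ((laurentReflection t).comp (laurentReflection t)) (AlgHom.id K K[T;T⁻¹]))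
    (by rw [AlgHom.mem_equalizer, AlgHom.comp_apply, laurentReflection_T_one,
      laurentReflection_C_mul_T_neg_one, Units.mul_inv, map_one, one_mul, AlgHom.id_apply])
    (by rw [AlgHom.mem_equalizer, AlgHom.comp_apply, laurentReflection_T_neg_one,
      laurentReflection_C_mul_T_one, Units.inv_mul, map_one, one_mul, AlgHom.id_apply])
  have hf : f ∈ AlgHom.equalizer ((laurentReflection t).comp (laurentReflection t))
    (AlgHom.id K K[T;T⁻¹]) := this ▸ trivial
  exact hf

/-! ### Demazure–Lusztig letters and their intertwiners -/

/-- `g` satisfies a quadratic relation and a Bernstein relation with the unit `W`, as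
Demazure–Lusztig operators do: moving `g` past `W` replaces `W` by `t W⁻¹`, up to a correction
`b(W)` in which `g` does not occur. -/
structure IsDemazureLetter (W : Rˣ) (t : Kˣ) (b : K[T;T⁻¹]) (α β : K) (g : R) : Prop where
  sq : g * g = α • g + algebraMap K R β
  comm : g * W = (t : K) • (↑W⁻¹ * g) + laurentEval W b

/-- The commutator of a letter with `W`; for a Demazure–Lusztig letter it is, up to
a factor, the part of the letter that acts as the reflection alone. -/
def intertwiner (W : Rˣ) (g : R) : R := g * W - W * g

namespace IsDemazureLetter

variable {W : Rˣ} {t : Kˣ} {b : K[T;T⁻¹]} {α β : K} {g : R}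

theorem comm_inv (h : IsDemazureLetter W t b α β g) :
    g * ↑W⁻¹ = (↑t⁻¹ : K) • (W * g - laurentEval W b) := by
  have hb : (W : R) * laurentEval W b * ↑W⁻¹ = laurentEval W b := by
    rw [← laurentEval_T_one (K := K) W, laurentEval_comm, laurentEval_T_one, mul_assoc,
      Units.mul_inv, mul_one]
  have hW : (W : R) * g = (t : K) • (g * ↑W⁻¹) + laurentEval W b := by
    have := congrArg (fun x => (W : R) * x * ↑W⁻¹) h.comm
    simp only [mul_add, add_mul, hb, mul_smul_comm, smul_mul_assoc,
      Units.mul_inv_cancel_left] at this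
    rw [← this, ← mul_assoc, mul_assoc _ _ (↑W⁻¹ : R), Units.mul_inv, mul_one]
  rw [hW, add_sub_cancel_right, smul_smul, Units.inv_mul, one_smul]

/-- The Bernstein relation for an arbitrary Laurent polynomial. -/
theorem exists_mul_laurentEval (h : IsDemazureLetter W t b α β g) (f : K[T;T⁻¹]) :
    ∃ f' : K[T;T⁻¹],
      g * laurentEval W f = laurentEval W (laurentReflection t f) * g + laurentEval W f' := by
  let P : Subalgebra K K[T;T⁻¹] :=
    { carrier := {f | ∃ f' : K[T;T⁻¹],
        g * laurentEval W f = laurentEval W (laurentReflection t f) * g + laurentEval W f'}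
      mul_mem' := by
        rintro x y ⟨x', hx⟩ ⟨y', hy⟩
        refine ⟨laurentReflection t x * y' + x' * y, ?_⟩
        simp only [map_mul, map_add]
        rw [← mul_assoc, hx, add_mul, mul_assoc _ g, hy, mul_add]
        noncomm_ring
      add_mem' := by
        rintro x y ⟨x', hx⟩ ⟨y', hy⟩
        refine ⟨x' + y', ?_⟩
        simp only [map_add]
        rw [mul_add, hx, hy]
        noncomm_ring
      algebraMap_mem' := fun c => ⟨0, by
        rw [AlgHom.commutes, AlgHom.commutes, AlgHom.commutes, map_zero, add_zero,
          Algebra.commutes]⟩ }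
  have hP : P = ⊤ := by
    refine laurent_subalgebra_eq_top P ⟨b, ?_⟩ ⟨-(C (↑t⁻¹ : K) * b), ?_⟩
    · rw [laurentEval_T_one, h.comm, laurentReflection_T_one, map_mul, laurentEval_C,
        laurentEval_T_neg_one, mul_assoc, ← Algebra.smul_def]
    · rw [laurentEval_T_neg_one, h.comm_inv, laurentReflection_T_neg_one, map_neg, map_mul, map_mul,
        laurentEval_C, laurentEval_T_one, mul_assoc, ← Algebra.smul_def, ← Algebra.smul_def,
        smul_sub, sub_eq_add_neg]
  exact (hP ▸ trivial : f ∈ P)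

theorem intertwiner_eq (h : IsDemazureLetter W t b α β g) :
    intertwiner W g = laurentEval W (C (t : K) * T (-1) - T 1) * g + laurentEval W b := by
  rw [intertwiner, h.comm, map_sub, map_mul, laurentEval_C, laurentEval_T_neg_one,
    laurentEval_T_one, sub_mul, mul_assoc, ← Algebra.smul_def]
  abel

theorem intertwiner_mul_unit (h : IsDemazureLetter W t b α β g) :
    intertwiner W g * W = (t : K) • (↑W⁻¹ * intertwiner W g) := by
  have hb : laurentEval W b * (W : R) = W * laurentEval W b := by
    rw [← laurentEval_T_one (K := K) W, laurentEval_comm]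
  have h1 : g * W * W = (t : K) • (↑W⁻¹ * (g * W)) + W * laurentEval W b := by
    conv_lhs => rw [h.comm]
    rw [add_mul, hb, smul_mul_assoc, mul_assoc]
  have h2 : (W : R) * (g * W) = (t : K) • g + W * laurentEval W b := by
    rw [h.comm, mul_add, mul_smul_comm, Units.mul_inv_cancel_left]
  rw [intertwiner, sub_mul, mul_assoc (W : R), h1, h2, mul_sub, smul_sub, Units.inv_mul_cancel_left]
  abel

theorem intertwiner_mul (h : IsDemazureLetter W t b α β g) (f : K[T;T⁻¹]) :
    intertwiner W g * laurentEval W f =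
      laurentEval W (laurentReflection t f) * intertwiner W g := by
  let P : Subalgebra K K[T;T⁻¹] :=
    { carrier := {f | intertwiner W g * laurentEval W f =
        laurentEval W (laurentReflection t f) * intertwiner W g}
      mul_mem' := by
        intro x y hx hy
        simp only [Set.mem_ofPred_eq, map_mul] at *
        rw [← mul_assoc, hx, mul_assoc, hy, mul_assoc]
      add_mem' := by
        intro x y hx hy
        simp only [Set.mem_ofPred_eq, map_add] at *
        rw [mul_add, hx, hy, add_mul]
      algebraMap_mem' := fun c => by
        change _ = _
        rw [AlgHom.commutes, AlgHom.commutes, AlgHom.commutes, Algebra.commutes] }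
  have hP : P = ⊤ := by
    refine laurent_subalgebra_eq_top P ?_ ?_
    · change _ = _
      rw [laurentEval_T_one, h.intertwiner_mul_unit, laurentReflection_T_one, map_mul,
        laurentEval_C, laurentEval_T_neg_one, mul_assoc, ← Algebra.smul_def]
    · change _ = _
      have := congrArg (fun x : R => (↑t⁻¹ : K) • ((W : R) * x * ↑W⁻¹)) h.intertwiner_mul_unit
      simp only [mul_smul_comm, smul_mul_assoc, smul_smul, Units.inv_mul, one_smul, mul_assoc,
        Units.mul_inv_cancel_left, Units.mul_inv, mul_one] at this
      rw [laurentEval_T_neg_one, ← this, laurentReflection_T_neg_one, map_mul,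
        laurentEval_C, laurentEval_T_one, mul_assoc, ← Algebra.smul_def]
  exact (hP ▸ trivial : f ∈ P)

/-- The square of the intertwiner is a Laurent polynomial in `W`. The hypothesis on `b` expresses
that the quadratic relation and the Bernstein relation are compatible. -/
theorem intertwiner_sq (h : IsDemazureLetter W t b α β g)
    (hb : laurentReflection t b - b = C α * (C (t : K) * T (-1) - T 1)) :
    intertwiner W g * intertwiner W g =
      laurentEval W (b * laurentReflection t b - C β * (C (t : K) * T (-1) - T 1) ^ 2) := by
  set a : K[T;T⁻¹] := C (t : K) * T (-1) - T 1 with ha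
  have ha' : laurentReflection t a = -a := by
    rw [ha, map_sub, laurentReflection_C_mul_T_neg_one, Units.mul_inv, map_one, one_mul,
      laurentReflection_T_one, neg_sub]
  have hb' : laurentReflection t b = b + C α * a := by rw [← hb]; ring
  have hag : laurentEval W a * g * g
      = laurentEval W (C α * a) * g + laurentEval W (C β * a) := by
    rw [mul_assoc, h.sq, mul_add, mul_smul_comm, map_mul, map_mul, laurentEval_C, laurentEval_C,
      mul_assoc, ← Algebra.smul_def, Algebra.commutes]
  calc intertwiner W g * intertwiner W g
      = intertwiner W g * laurentEval W a * g + intertwiner W g * laurentEval W b := by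
        rw [mul_assoc, ← mul_add, ← h.intertwiner_eq]
    _ = laurentEval W (-a) * (intertwiner W g * g)
        + laurentEval W (b + C α * a) * intertwiner W g := by
        rw [h.intertwiner_mul, h.intertwiner_mul, ha', hb', mul_assoc]
    _ = laurentEval W (-a) * (laurentEval W (C α * a) * g + laurentEval W (C β * a)
          + laurentEval W b * g)
        + laurentEval W (b + C α * a) * (laurentEval W a * g + laurentEval W b) := by
        rw [h.intertwiner_eq, ← ha, add_mul, hag]
    _ = laurentEval W (-a * (C α * a) - a * b + (b + C α * a) * a) * g
        + laurentEval W ((b + C α * a) * b - C β * a ^ 2) := by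
        have h1 : laurentEval W (-a * (C β * a)) = -laurentEval W (C β * a ^ 2) := by
          rw [← map_neg]
          ring_nf
        rw [map_sub _ _ (C β * a ^ 2), sub_eq_add_neg _ (laurentEval W (C β * a ^ 2)), ← h1]
        simp only [map_add, map_mul, map_sub, map_neg]
        noncomm_ring
    _ = _ := by
        rw [hb', show -a * (C α * a) - a * b + (b + C α * a) * a = 0 by ring, map_zero, zero_mul,
          zero_add, mul_comm b]

end IsDemazureLetter

end Laurent

/-! ### Alternating words in two letters -/

/-- The word `x y x y ⋯` of length `n`. -/
def alternatingWord {R : Type*} [Monoid R] : R → R → ℕ → R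
  | _, _, 0 => 1
  | x, y, n + 1 => x * alternatingWord y x n

/-- The alternating words in `x` and `y`, indexed by the integers: for `k ≥ 0` the word of length
`k` that starts with `x`, for `k < 0` the word of length `-k` that starts with `y`. Left
multiplication by `x` and by `y` corresponds to the reflections `k ↦ 1 - k` and `k ↦ -1 - k`. -/
def dihedralWord {R : Type*} [Monoid R] (x y : R) : ℤ → R
  | .ofNat n => alternatingWord x y n
  | .negSucc n => alternatingWord y x (n + 1)

section Words

variable {R : Type*} [Monoid R] (x y : R)

theorem dihedralWord_zero : dihedralWord x y 0 = 1 := rfl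

theorem dihedralWord_of_pos {k : ℤ} (hk : 1 ≤ k) :
    dihedralWord x y k = x * dihedralWord x y (1 - k) := by
  obtain ⟨n, rfl⟩ : ∃ n : ℕ, k = n + 1 := ⟨(k - 1).toNat, by omega⟩
  rcases n with _ | n
  · rfl
  · rw [show (1 : ℤ) - (((n + 1 : ℕ) : ℤ) + 1) = Int.negSucc n by omega,
      show ((n + 1 : ℕ) : ℤ) + 1 = Int.ofNat (n + 2) by simp; ring]
    rfl

theorem dihedralWord_of_neg {k : ℤ} (hk : k ≤ -1) :
    dihedralWord x y k = y * dihedralWord x y (-1 - k) := by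
  obtain ⟨n, rfl⟩ : ∃ n : ℕ, k = -1 - n := ⟨(-1 - k).toNat, by omega⟩
  rw [show (-1 : ℤ) - (-1 - n) = Int.ofNat n by simp, show (-1 : ℤ) - n = Int.negSucc n by omega]
  rfl

theorem map_dihedralWord {R' F : Type*} [Monoid R'] [FunLike F R R'] [MonoidHomClass F R R']
    (φ : F) (k : ℤ) : φ (dihedralWord x y k) = dihedralWord (φ x) (φ y) k := by
  have h : ∀ (n : ℕ) (x y : R), φ (alternatingWord x y n) = alternatingWord (φ x) (φ y) n := by
    intro n
    induction n with
    | zero => intro x y; exact map_one φ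
    | succ n ih => intro x y; rw [alternatingWord, map_mul, ih]; rfl
  rcases k with n | n <;> exact h _ _ _

end Words

/-- Induction along the two reflections of the integers that fix no element and generate an
infinite dihedral group. -/
theorem dihedral_induction {P : ℤ → Prop} (zero : P 0) (pos : ∀ k, 1 ≤ k → P (1 - k) → P k)
    (neg : ∀ k, k ≤ -1 → P (-1 - k) → P k) (k : ℤ) : P k := by
  obtain ⟨n, hn⟩ : ∃ n : ℕ, n = k.natAbs := ⟨_, rfl⟩
  induction n generalizing k with
  | zero => rwa [Int.natAbs_eq_zero.1 hn.symm]
  | succ n ih =>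
    rcases lt_trichotomy k 0 with h | h | h
    · exact neg k (by omega) (ih _ (by omega))
    · omega
    · exact pos k (by omega) (ih _ (by omega))

/-! ### Left modules over Laurent polynomials -/

section Pair

open LaurentPolynomial

variable {K : Type*} [Field K] {R : Type*} [Ring R] [Algebra K R]

/-- The left module structure over Laurent polynomials given by evaluation at `W`. -/
noncomputable abbrev laurentModule (K : Type*) [Field K] {R : Type*} [Ring R] [Algebra K R]
    (W : Rˣ) :
    Module K[T;T⁻¹] R :=
  Module.compHom R (laurentEval W : K[T;T⁻¹] →ₐ[K] R).toRingHom

/-- The left `K[W, W⁻¹]`-submodule spanned by a set. -/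
noncomputable def laurentSpan (K : Type*) [Field K] {R : Type*} [Ring R] [Algebra K R] (W : Rˣ)
    (S : Set R) :
    @Submodule K[T;T⁻¹] R _ _ (laurentModule K W) :=
  letI := laurentModule K W
  Submodule.span K[T;T⁻¹] S

variable {W : Rˣ} {S : Set R}

theorem laurentEval_mul_mem (f : K[T;T⁻¹]) {m : R} (hm : m ∈ laurentSpan K W S) :
    laurentEval W f * m ∈ laurentSpan K W S :=
  let := laurentModule K W
  Submodule.smul_mem _ f hm

theorem smul_mem_laurentSpan (c : K) {m : R} (hm : m ∈ laurentSpan K W S) :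
    c • m ∈ laurentSpan K W S := by
  have := laurentEval_mul_mem (C c) hm
  rwa [laurentEval_C, ← Algebra.smul_def] at this

/-- Left multiplication by a letter maps the span of `S` to a submodule `B` as soon as it maps `S`
there and `S` itself lies in `B`. -/
theorem IsDemazureLetter.mul_mem_laurentSpan {t : Kˣ} {b : K[T;T⁻¹]} {α β : K} {g : R}
    (h : IsDemazureLetter W t b α β g) {S' : Set R} (hS : S ⊆ laurentSpan K W S')
    (hg : ∀ s ∈ S, g * s ∈ laurentSpan K W S') {m : R} (hm : m ∈ laurentSpan K W S) :
    g * m ∈ laurentSpan K W S' := by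
  let := laurentModule K W
  have hle : laurentSpan K W S ≤ laurentSpan K W S' := Submodule.span_le.2 hS
  refine Submodule.span_induction (p := fun m _ => g * m ∈ laurentSpan K W S') hg ?_ ?_ ?_ hm
  · simp
  · intro a b _ _ ha hb
    rw [mul_add]
    exact add_mem ha hb
  · intro f m hm ih
    obtain ⟨f', hf'⟩ := h.exists_mul_laurentEval f
    change g * (laurentEval W f * m) ∈ _
    rw [← mul_assoc, hf', add_mul, mul_assoc]
    exact add_mem (laurentEval_mul_mem _ ih) (laurentEval_mul_mem _ (hle hm))

variable {t t' : Kˣ} {b b' : K[T;T⁻¹]} {α β α' β' : K} {x y : R}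

theorem dihedralWord_mem_laurentSpan {I : Set ℤ} {k : ℤ} (hk : k ∈ I) :
    dihedralWord x y k ∈ laurentSpan K W (dihedralWord x y '' I) :=
  let := laurentModule K W
  Submodule.subset_span ⟨k, hk, rfl⟩

theorem left_mul_dihedralWord_mem (hx : IsDemazureLetter W t b α β x) {I : Set ℤ} {k : ℤ}
    (h₁ : k ∈ I) (h₂ : 1 - k ∈ I) :
    x * dihedralWord x y k ∈ laurentSpan K W (dihedralWord x y '' I) := by
  let := laurentModule K W
  rcases le_or_gt 1 k with hk | hk
  · rw [dihedralWord_of_pos x y hk, ← mul_assoc, hx.sq, add_mul, smul_mul_assoc,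
      ← dihedralWord_of_pos x y hk, ← Algebra.smul_def]
    exact add_mem (smul_mem_laurentSpan _ (dihedralWord_mem_laurentSpan h₁))
      (smul_mem_laurentSpan _ (dihedralWord_mem_laurentSpan h₂))
  · have := dihedralWord_of_pos x y (k := 1 - k) (by omega)
    rw [sub_sub_cancel] at this
    rw [← this]
    exact dihedralWord_mem_laurentSpan h₂

theorem right_mul_dihedralWord_mem (hy : IsDemazureLetter W t' b' α' β' y) {I : Set ℤ} {k : ℤ}
    (h₁ : k ∈ I) (h₂ : -1 - k ∈ I) :
    y * dihedralWord x y k ∈ laurentSpan K W (dihedralWord x y '' I) := by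
  let := laurentModule K W
  rcases le_or_gt k (-1) with hk | hk
  · rw [dihedralWord_of_neg x y hk, ← mul_assoc, hy.sq, add_mul, smul_mul_assoc,
      ← dihedralWord_of_neg x y hk, ← Algebra.smul_def]
    exact add_mem (smul_mem_laurentSpan _ (dihedralWord_mem_laurentSpan h₁))
      (smul_mem_laurentSpan _ (dihedralWord_mem_laurentSpan h₂))
  · have := dihedralWord_of_neg x y (k := -1 - k) (by omega)
    rw [sub_sub_cancel] at this
    rw [← this]
    exact dihedralWord_mem_laurentSpan h₂

/-- An algebra generated by `W`, `W⁻¹` and two letters is spanned by the alternating words in the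
letters, with coefficients in `K[W, W⁻¹]` on the left. -/
theorem mem_laurentSpan_dihedralWord (hx : IsDemazureLetter W t b α β x)
    (hy : IsDemazureLetter W t' b' α' β' y)
    (hgen : Algebra.adjoin K {(W : R), (↑W⁻¹ : R), x, y} = ⊤) (m : R) :
    m ∈ laurentSpan K W (Set.range (dihedralWord x y)) := by
  let := laurentModule K W
  let P : Subalgebra K R :=
    { carrier := {a | ∀ m ∈ laurentSpan K W (Set.range (dihedralWord x y)),
        a * m ∈ laurentSpan K W (Set.range (dihedralWord x y))}
      mul_mem' := by
        intro a b ha hb m hm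
        rw [mul_assoc]
        exact ha _ (hb _ hm)
      add_mem' := by
        intro a b ha hb m hm
        rw [add_mul]
        exact add_mem (ha _ hm) (hb _ hm)
      algebraMap_mem' := by
        intro c m hm
        rw [← Algebra.smul_def]
        exact smul_mem_laurentSpan c hm }
  have hP : P = ⊤ := by
    rw [eq_top_iff, ← hgen, Algebra.adjoin_le_iff]
    rintro a (rfl | rfl | rfl | rfl) m hm
    · rw [← laurentEval_T_one (K := K)]
      exact laurentEval_mul_mem _ hm
    · rw [← laurentEval_T_neg_one (K := K)]
      exact laurentEval_mul_mem _ hm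
    · refine hx.mul_mem_laurentSpan Submodule.subset_span ?_ hm
      rintro _ ⟨k, rfl⟩
      rw [← Set.image_univ]
      exact left_mul_dihedralWord_mem hx trivial trivial
    · refine hy.mul_mem_laurentSpan Submodule.subset_span ?_ hm
      rintro _ ⟨k, rfl⟩
      rw [← Set.image_univ]
      exact right_mul_dihedralWord_mem hy trivial trivial
  have hm : m ∈ P := hP ▸ trivial
  rw [← mul_one m]
  exact hm 1 (Submodule.subset_span ⟨0, rfl⟩)

/-! ### Independence of the alternating words -/

/-- The Laurent polynomial into which `X` is transformed when it moves past the `k`-th alternating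
word in the reflections `X ↦ X⁻¹` and `X ↦ q⁻¹ X⁻¹`. -/
noncomputable def dihedralCharacter (q : Kˣ) (k : ℤ) : K[T;T⁻¹] :=
  if Even k then C (↑(q ^ (-(k / 2))) : K) * T 1 else C (↑(q ^ ((k - 1) / 2)) : K) * T (-1)

theorem dihedralCharacter_of_pos (q : Kˣ) (k : ℤ) :
    laurentReflection 1 (dihedralCharacter q (1 - k)) = dihedralCharacter q k := by
  rcases Int.even_or_odd' k with ⟨j, rfl | rfl⟩
  · rw [dihedralCharacter, dihedralCharacter, if_neg (by grind), if_pos (by grind),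
      laurentReflection_C_mul_T_neg_one, show (1 - 2 * j - 1) / 2 = -j by omega,
      show 2 * j / 2 = j by omega]
    simp
  · rw [dihedralCharacter, dihedralCharacter, if_pos (by grind), if_neg (by grind),
      laurentReflection_C_mul_T_one, show -((1 - (2 * j + 1)) / 2) = j by omega,
      show (2 * j + 1 - 1) / 2 = j by omega]
    simp

theorem dihedralCharacter_of_neg (q : Kˣ) (k : ℤ) :
    laurentReflection q⁻¹ (dihedralCharacter q (-1 - k)) = dihedralCharacter q k := by
  rcases Int.even_or_odd' k with ⟨j, rfl | rfl⟩
  · rw [dihedralCharacter, dihedralCharacter, if_neg (by grind), if_pos (by grind),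
      laurentReflection_C_mul_T_neg_one, show (-1 - 2 * j - 1) / 2 = -j - 1 by omega,
      show 2 * j / 2 = j by omega, ← Units.val_mul, inv_inv,
      ← zpow_add_one, sub_add_cancel]
  · rw [dihedralCharacter, dihedralCharacter, if_pos (by grind), if_neg (by grind),
      laurentReflection_C_mul_T_one, show -((-1 - (2 * j + 1)) / 2) = j + 1 by omega,
      show (2 * j + 1 - 1) / 2 = j by omega, ← Units.val_mul, zpow_add_one,
      mul_inv_cancel_right]

theorem zpow_injective_of_pow_ne_one {G : Type*} [Group G] {q : G}
    (hq : ∀ m : ℕ, 0 < m → q ^ m ≠ 1) : Function.Injective (fun n : ℤ => q ^ n) := by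
  rw [injective_zpow_iff_not_isOfFinOrder, isOfFinOrder_iff_pow_eq_one]
  push Not
  exact hq

theorem dihedralCharacter_injective {q : Kˣ} (hq : ∀ m : ℕ, 0 < m → q ^ m ≠ 1) :
    Function.Injective (dihedralCharacter q) := by
  have hinj := zpow_injective_of_pow_ne_one hq
  intro k l h
  have key : ∀ {c c' : Kˣ} {m n : ℤ}, (C (c : K) * T m : K[T;T⁻¹]) = C (c' : K) * T n →
      m = n ∧ c = c' := fun {c c' m n} h =>
    (LaurentPolynomial.C_mul_T_injective c.ne_zero h).imp_right Units.ext
  unfold dihedralCharacter at h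
  split_ifs at h with h1 h2 h2
  · have := hinj (key h).2
    grind
  · exact absurd (key h).1 (by norm_num)
  · exact absurd (key h).1 (by norm_num)
  · have := hinj (key h).2
    grind

/-- The alternating words in two Demazure–Lusztig letters for the reflections `X ↦ X⁻¹` and
`X ↦ q⁻¹ X⁻¹` are linearly independent over `K[W, W⁻¹]`, provided that `q` is not a root of unity,
`W` is transcendental, and the squares of the intertwiners do not vanish. The alternating words in
the intertwiners are eigenvectors of right multiplication by `W` with distinct eigenvalues, hence
independent, and those of length at most `n` lie in the span of the words of length at most
`n` in the letters, which are equally many. -/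
theorem linearIndependent_dihedralWord {q : Kˣ} (hq : ∀ m : ℕ, 0 < m → q ^ m ≠ 1)
    (hW : Function.Injective (laurentEval W : K[T;T⁻¹] →ₐ[K] R))
    (hx : IsDemazureLetter W 1 b α β x) (hy : IsDemazureLetter W q⁻¹ b' α' β' y)
    {N N' : K[T;T⁻¹]} (hN : N ≠ 0) (hN' : N' ≠ 0)
    (hxN : intertwiner W x * intertwiner W x = laurentEval W N)
    (hyN : intertwiner W y * intertwiner W y = laurentEval W N') :
    letI := laurentModule K W
    LinearIndependent K[T;T⁻¹] (dihedralWord x y) := by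
  let := laurentModule K W
  set s : ℤ → R := dihedralWord (intertwiner W x) (intertwiner W y) with hs
  have hspos : ∀ k, 1 ≤ k → s k = intertwiner W x * s (1 - k) := fun k hk =>
    dihedralWord_of_pos _ _ hk
  have hsneg : ∀ k, k ≤ -1 → s k = intertwiner W y * s (-1 - k) := fun k hk =>
    dihedralWord_of_neg _ _ hk
  have heigen : ∀ k, s k * W = laurentEval W (dihedralCharacter q k) * s k := by
    intro k
    induction k using dihedral_induction with
    | zero => simp [hs, dihedralWord_zero, dihedralCharacter, laurentEval_T_one]
    | pos k hk ih =>
      rw [hspos k hk, mul_assoc, ih, ← mul_assoc, hx.intertwiner_mul, dihedralCharacter_of_pos,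
        mul_assoc]
    | neg k hk ih =>
      rw [hsneg k hk, mul_assoc, ih, ← mul_assoc, hy.intertwiner_mul, dihedralCharacter_of_neg,
        mul_assoc]
  -- Multiplying `f(W) S m = 0` by the intertwiner `S` gives `(σ f · N)(W) m = 0`.
  have hstep : ∀ {t : Kˣ} {b N : K[T;T⁻¹]} {α β : K} {g : R}, IsDemazureLetter W t b α β g →
      N ≠ 0 → intertwiner W g * intertwiner W g = laurentEval W N →
      ∀ m : R, (∀ f : K[T;T⁻¹], laurentEval W f * m = 0 → f = 0) →
      ∀ f : K[T;T⁻¹], laurentEval W f * (intertwiner W g * m) = 0 → f = 0 := by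
    intro t b N α β g hg hN hgN m hm f hf
    have h := congrArg (fun z => intertwiner W g * z) hf
    simp only [mul_zero] at h
    rw [← mul_assoc, hg.intertwiner_mul, mul_assoc, ← mul_assoc _ _ m, hgN, ← mul_assoc,
      ← map_mul] at h
    rw [← laurentReflection_laurentReflection t f, (mul_eq_zero.1 (hm _ h)).resolve_right hN,
      map_zero]
  have hfree : ∀ k (f : K[T;T⁻¹]), laurentEval W f * s k = 0 → f = 0 := by
    intro k
    induction k using dihedral_induction with
    | zero =>
      intro f hf
      rw [hs, dihedralWord_zero, mul_one] at hf
      exact hW (hf.trans (map_zero _).symm)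
    | pos k hk ih => rw [hspos k hk]; exact hstep hx hN hxN _ ih
    | neg k hk ih => rw [hsneg k hk]; exact hstep hy hN' hyN _ ih
  have hind : LinearIndependent K[T;T⁻¹] s :=
    linearIndependent_of_eigenvectors
      { toFun := fun r : R => r * (W : R)
        map_add' := fun r r' : R => add_mul r r' _
        map_smul' := fun f r => mul_assoc (laurentEval W f) r (W : R) }
      s (dihedralCharacter q) (dihedralCharacter_injective hq) heigen hfree
  -- Each intertwiner `g W - W g` lengthens words by at most one letter, as the letter `g` does.
  have hmem : ∀ (n : ℕ) (k : ℤ), k.natAbs ≤ n →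
      s k ∈ laurentSpan K W (dihedralWord x y '' Set.Icc (-n : ℤ) n) := by
    have hint : ∀ {t : Kˣ} {b : K[T;T⁻¹]} {α β : K} {g m : R} {S S' : Set R},
        IsDemazureLetter W t b α β g → S ⊆ laurentSpan K W S' →
        (∀ s ∈ S, g * s ∈ laurentSpan K W S') → m ∈ laurentSpan K W S →
        intertwiner W g * m ∈ laurentSpan K W S' := by
      intro t b α β g m S S' hg hS hgS hm
      rw [intertwiner, sub_mul, mul_assoc, mul_assoc, ← laurentEval_T_one (K := K) W]
      exact sub_mem (hg.mul_mem_laurentSpan hS hgS (laurentEval_mul_mem _ hm))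
        (laurentEval_mul_mem _ (hg.mul_mem_laurentSpan hS hgS hm))
    intro n
    induction n with
    | zero =>
      intro k hk
      obtain rfl : k = 0 := by omega
      exact dihedralWord_mem_laurentSpan (x := x) (y := y) (I := Set.Icc _ _) (k := 0) (by simp)
    | succ n ih =>
      have hsub : dihedralWord x y '' Set.Icc (-n : ℤ) n ⊆
          laurentSpan K W (dihedralWord x y '' Set.Icc (-(n + 1 : ℕ) : ℤ) (n + 1 : ℕ)) := by
        rintro _ ⟨j, hj, rfl⟩
        refine dihedralWord_mem_laurentSpan ?_
        rw [Set.mem_Icc] at *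
        omega
      intro k hk
      rcases lt_trichotomy k 0 with h | rfl | h
      · rw [hsneg k (by omega)]
        refine hint hy hsub ?_ (ih _ (by omega))
        rintro _ ⟨j, hj, rfl⟩
        rw [Set.mem_Icc] at hj
        exact right_mul_dihedralWord_mem hy (Set.mem_Icc.2 (by omega)) (Set.mem_Icc.2 (by omega))
      · exact dihedralWord_mem_laurentSpan (x := x) (y := y) (k := 0) (Set.mem_Icc.2 (by omega))
      · rw [hspos k (by omega)]
        refine hint hx hsub ?_ (ih _ (by omega))
        rintro _ ⟨j, hj, rfl⟩
        rw [Set.mem_Icc] at hj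
        exact left_mul_dihedralWord_mem hx (Set.mem_Icc.2 (by omega)) (Set.mem_Icc.2 (by omega))
  -- A relation involves only finitely many words, so it lives in some interval `[-n, n]`.
  rw [linearIndependent_iff']
  intro F f hf i hi
  obtain ⟨n, hn⟩ : ∃ n : ℕ, F ⊆ Finset.Icc (-n : ℤ) n := by
    refine ⟨F.sup Int.natAbs, fun j hj => ?_⟩
    have := Finset.le_sup (f := Int.natAbs) hj
    rw [Finset.mem_Icc]
    omega
  have hindn : LinearIndependent K[T;T⁻¹]
      (fun k : Finset.Icc (-n : ℤ) n => dihedralWord x y k) := by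
    refine LinearIndependent.of_mem_span (hind.comp _ Subtype.val_injective) fun k => ?_
    have := hmem n k (by have := Finset.mem_Icc.1 k.2; omega)
    change s k ∈ _
    convert this using 2
    rw [laurentSpan]
    congr 1
    ext z
    simp
  have hon : LinearIndepOn K[T;T⁻¹] (dihedralWord x y) (Finset.Icc (-n : ℤ) n : Finset ℤ) := hindn
  exact linearIndepOn_finset_iff.1 (hon.mono (by exact_mod_cast hn)) f hf i hi

/-- A homomorphism out of an algebra generated by `W`, `W⁻¹` and two Demazure–Lusztig letters for
the reflections `X ↦ X⁻¹` and `X ↦ q⁻¹ X⁻¹` is injective as soon as it is injective on Laurent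
polynomials in `W`: the alternating words span the source, and their images are independent. -/
theorem injective_of_injective_comp_laurentEval {R' : Type*} [Ring R'] [Algebra K R'] {q : Kˣ}
    (hq : ∀ m : ℕ, 0 < m → q ^ m ≠ 1) (φ : R →ₐ[K] R')
    (hφ : Function.Injective fun f : K[T;T⁻¹] => φ (laurentEval W f))
    (hx : IsDemazureLetter W 1 b α β x) (hy : IsDemazureLetter W q⁻¹ b' α' β' y)
    (hb : laurentReflection 1 b - b = C α * (C ((1 : Kˣ) : K) * T (-1) - T 1))
    (hb' : laurentReflection q⁻¹ b' - b' = C α' * (C (↑q⁻¹ : K) * T (-1) - T 1))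
    (hN : b * laurentReflection 1 b - C β * (C ((1 : Kˣ) : K) * T (-1) - T 1) ^ 2 ≠ 0)
    (hN' : b' * laurentReflection q⁻¹ b' - C β' * (C (↑q⁻¹ : K) * T (-1) - T 1) ^ 2 ≠ 0)
    (hgen : Algebra.adjoin K {(W : R), (↑W⁻¹ : R), x, y} = ⊤) : Function.Injective φ := by
  have hmap : ∀ {t : Kˣ} {b : K[T;T⁻¹]} {α β : K} {g : R}, IsDemazureLetter W t b α β g →
      IsDemazureLetter (Units.map (φ : R →* R') W) t b α β (φ g) := by
    intro t b α β g h
    refine ⟨?_, ?_⟩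
    · rw [← map_mul, h.sq, map_add, map_smul, AlgHom.commutes]
    · have := congrArg φ h.comm
      rw [map_mul, map_add, map_smul, map_mul, map_laurentEval] at this
      exact this
  have hind := linearIndependent_dihedralWord hq (W := Units.map (φ : R →* R') W)
    (fun f g h => hφ (by simpa only [map_laurentEval] using h)) (hmap hx) (hmap hy) hN hN'
    ((hmap hx).intertwiner_sq hb) ((hmap hy).intertwiner_sq hb')
  let := laurentModule K W
  let := laurentModule K (Units.map (φ : R →* R') W)
  let Φ : R →ₗ[K[T;T⁻¹]] R' :=
    { toFun := φ
      map_add' := map_add φ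
      map_smul' := fun f r => by
        change φ (laurentEval W f * r) = laurentEval _ f * φ r
        rw [map_mul, map_laurentEval] }
  refine (injective_iff_map_eq_zero φ).2 fun m hm => ?_
  obtain ⟨c, rfl⟩ := (Finsupp.mem_span_range_iff_exists_finsupp).1
    (mem_laurentSpan_dihedralWord hx hy hgen m)
  have hc : Finsupp.linearCombination K[T;T⁻¹] (dihedralWord (φ x) (φ y)) c = 0 := by
    rw [← hm, Finsupp.linearCombination_apply]
    change _ = Φ _
    rw [Finsupp.sum, Finsupp.sum, map_sum]
    refine Finset.sum_congr rfl fun k _ => ?_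
    rw [map_smul]
    exact congrArg _ (map_dihedralWord x y φ k).symm
  rw [(linearIndependent_iff.1 hind) c hc, Finsupp.sum_zero_index]

end Pair

/-! ### The letters of the confluent Cherednik algebra -/

section ConfluentCherednik

open LaurentPolynomial

variable {R : Type*} [Ring R] [Algebra ℂ R]

theorem mul_self_of_hecke {k : ℂ} (hk : k ≠ 0) {V : R}
    (h : (V - algebraMap ℂ R k) * (V + algebraMap ℂ R k⁻¹) = 0) :
    V * V = (k - k⁻¹) • V + algebraMap ℂ R 1 := by
  rw [← sub_eq_zero, ← h, sub_mul, mul_add, mul_add, ← map_mul, mul_inv_cancel₀ hk,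
    ← Algebra.commutes k⁻¹ V, ← Algebra.smul_def, ← Algebra.smul_def, sub_smul]
  abel

namespace SatisfiesHV

variable {r k₁ u₀ u₁ : ℂ} {V₀ V₁ cV₀ cV₁ : R}

/-- The product `V̌₁ V₁` as a unit. -/
noncomputable def unit (h : SatisfiesHV r k₁ u₀ u₁ V₀ V₁ cV₀ cV₁) (hk₁ : k₁ ≠ 0)
    (hu₁ : u₁ ≠ 0) : Rˣ where
  val := cV₁ * V₁
  inv := (V₁ - (k₁ - k₁⁻¹) • 1) * (cV₁ - (u₁ - u₁⁻¹) • 1)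
  val_inv := by
    have h1 : V₁ * (V₁ - (k₁ - k₁⁻¹) • 1) = 1 := by
      rw [mul_sub, mul_self_of_hecke hk₁ h.rel2, mul_smul_comm, mul_one, map_one,
        add_sub_cancel_left]
    have h2 : cV₁ * (cV₁ - (u₁ - u₁⁻¹) • 1) = 1 := by
      rw [mul_sub, mul_self_of_hecke hu₁ h.rel4, mul_smul_comm, mul_one, map_one,
        add_sub_cancel_left]
    rw [mul_assoc, ← mul_assoc V₁, h1, one_mul, h2]
  inv_val := by
    have h1 : (V₁ - (k₁ - k₁⁻¹) • 1) * V₁ = 1 := by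
      rw [sub_mul, mul_self_of_hecke hk₁ h.rel2, smul_mul_assoc, one_mul, map_one,
        add_sub_cancel_left]
    have h2 : (cV₁ - (u₁ - u₁⁻¹) • 1) * cV₁ = 1 := by
      rw [sub_mul, mul_self_of_hecke hu₁ h.rel4, smul_mul_assoc, one_mul, map_one,
        add_sub_cancel_left]
    rw [mul_assoc, ← mul_assoc _ cV₁, h2, one_mul, h1]

variable (h : SatisfiesHV r k₁ u₀ u₁ V₀ V₁ cV₀ cV₁) (hk₁ : k₁ ≠ 0) (hu₁ : u₁ ≠ 0)

/-- `V₁` is a letter for the reflection `X ↦ X⁻¹`. -/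
theorem isDemazureLetter_V₁ : IsDemazureLetter (h.unit hk₁ hu₁) 1
    (C (k₁ - k₁⁻¹) * T 1 + C (u₁ - u₁⁻¹)) (k₁ - k₁⁻¹) 1 V₁ where
  sq := mul_self_of_hecke hk₁ h.rel2
  comm := by
    rw [Units.val_one, one_smul, map_add, map_mul, laurentEval_C, laurentEval_C,
      laurentEval_T_one, Algebra.algebraMap_eq_smul_one, Algebra.algebraMap_eq_smul_one]
    change V₁ * (cV₁ * V₁) = (V₁ - (k₁ - k₁⁻¹) • 1) * (cV₁ - (u₁ - u₁⁻¹) • 1) * V₁ +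
      (((k₁ - k₁⁻¹) • 1) * (cV₁ * V₁) + (u₁ - u₁⁻¹) • 1)
    have hsq := mul_self_of_hecke hk₁ h.rel2
    rw [map_one] at hsq
    simp only [sub_mul, mul_sub, smul_mul_assoc, mul_smul_comm, one_mul, mul_one, hsq,
      add_sub_cancel_left, mul_assoc]
    abel

/-- The last two relations combined: eliminating `V̌₀` gives the Bernstein relation between `V₀`
and `V̌₁ V₁`. -/
theorem V₀_mul_unit {q : ℂˣ} (hr : r ^ 2 = q) :
    V₀ * (h.unit hk₁ hu₁ : R) = (↑q⁻¹ : ℂ) • (↑(h.unit hk₁ hu₁)⁻¹ * V₀ + ↑(h.unit hk₁ hu₁)⁻¹ +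
      (r * u₀⁻¹) • 1) := by
  set W := h.unit hk₁ hu₁ with hW
  have hcV₀ : cV₀ = r • ((W : R) * V₀) - u₀⁻¹ • 1 := by
    rw [← Algebra.algebraMap_eq_smul_one]
    exact eq_sub_of_add_eq h.rel5.symm
  have h6 : r • (cV₀ * (W : R)) = V₀ + 1 := by
    rw [← h.rel6, mul_assoc]
    rfl
  have h7 : (q : ℂ) • ((W : R) * V₀ * W) = V₀ + 1 + (r * u₀⁻¹) • (W : R) := by
    rw [← h6, hcV₀, sub_mul, smul_sub, smul_mul_assoc, smul_smul, smul_mul_assoc, one_mul,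
      smul_smul, sub_add_cancel, ← hr, pow_two]
  have h8 := congrArg (fun z : R => (↑q⁻¹ : ℂ) • ((↑W⁻¹ : R) * z)) h7
  simp only [mul_smul_comm, smul_smul, Units.inv_mul, one_smul, mul_assoc,
    Units.inv_mul_cancel_left, mul_add, mul_one] at h8
  rw [h8]

/-- `-V₀` is a letter for the reflection `X ↦ q⁻¹ X⁻¹`. -/
theorem isDemazureLetter_neg_V₀ {q : ℂˣ} (hr : r ^ 2 = q) : IsDemazureLetter (h.unit hk₁ hu₁) q⁻¹
    (C (↑q⁻¹ : ℂ) * (C (-(r * u₀⁻¹)) - T (-1))) 1 0 (-V₀) where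
  sq := by
    have := h.rel1
    rw [pow_two] at this
    rw [neg_mul_neg, one_smul, map_zero, add_zero]
    exact eq_neg_of_add_eq_zero_left this
  comm := by
    rw [neg_mul, h.V₀_mul_unit hk₁ hu₁ hr, map_mul, map_sub, laurentEval_C, laurentEval_C,
      laurentEval_T_neg_one, Algebra.algebraMap_eq_smul_one, Algebra.algebraMap_eq_smul_one,
      smul_mul_assoc, one_mul, ← smul_neg, ← smul_add, neg_smul, mul_neg]
    congr 1
    abel

end SatisfiesHV

/-- Compatibility of the quadratic and the Bernstein relation for the letter `V₁`. -/
theorem laurentReflection_sub_V₁ (κ μ : ℂ) :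
    laurentReflection 1 (C κ * T 1 + C μ) - (C κ * T 1 + C μ) =
      C κ * (C ((1 : ℂˣ) : ℂ) * T (-1) - T 1) := by
  rw [map_add, laurentReflection_C_mul_T_one, laurentReflection_C, Units.val_one, map_one, mul_one]
  ring

/-- Compatibility of the quadratic and the Bernstein relation for the letter `-V₀`. -/
theorem laurentReflection_sub_V₀ (t : ℂˣ) (d : ℂ) :
    laurentReflection t (C (t : ℂ) * (C d - T (-1))) - C (t : ℂ) * (C d - T (-1)) =
      C 1 * (C (t : ℂ) * T (-1) - T 1) := by
  rw [mul_sub, map_sub, laurentReflection_C_mul_T_neg_one, map_mul, laurentReflection_C,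
    laurentReflection_C, Units.mul_inv, map_one]
  ring

/-- The square of the intertwiner of `V₁` does not vanish: its coefficient at `X ^ 2` is `-1`. -/
theorem intertwiner_sq_V₁_ne_zero (κ μ : ℂ) :
    (C κ * T 1 + C μ) * laurentReflection 1 (C κ * T 1 + C μ) -
      C 1 * (C ((1 : ℂˣ) : ℂ) * T (-1) - T 1) ^ 2 ≠ 0 := by
  intro h
  have hT : (T (-1) * T 1 : ℂ[T;T⁻¹]) = 1 := by rw [← T_add]; simp
  have h1 : (T (-1) ^ 2 : ℂ[T;T⁻¹]) = C 1 * T (-2) := by simp [T_pow]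
  have h2 : (T 1 ^ 2 : ℂ[T;T⁻¹]) = C 1 * T 2 := by simp [T_pow]
  have h3 : (C κ * T 1 + C μ) * laurentReflection 1 (C κ * T 1 + C μ) -
      C 1 * (C ((1 : ℂˣ) : ℂ) * T (-1) - T 1) ^ 2 =
      C (κ * μ) * T 1 + C (κ * μ) * T (-1) + C (κ * κ + μ * μ + 2) * T 0
        - C 1 * T (-2) - C 1 * T 2 := by
    rw [map_add, laurentReflection_C_mul_T_one, laurentReflection_C, ← h1, ← h2]
    simp only [map_add, map_mul, T_zero, Units.val_one, map_one, map_ofNat]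
    linear_combination (C κ * C κ + 2) * hT
  rw [h3] at h
  have := congrArg (fun f => f.coeff 2) h
  simp [AddMonoidAlgebra.coeff_add, AddMonoidAlgebra.coeff_sub, LaurentPolynomial.coeff_C_mul_T,
    -map_mul, -map_add, -map_one] at this

/-- The square of the intertwiner of `-V₀` does not vanish, being a product of a nonzero Laurent
polynomial and its reflection. -/
theorem intertwiner_sq_V₀_ne_zero (t : ℂˣ) {d : ℂ} :
    C (t : ℂ) * (C d - T (-1)) * laurentReflection t (C (t : ℂ) * (C d - T (-1))) -
      C 0 * (C (t : ℂ) * T (-1) - T 1) ^ 2 ≠ 0 := by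
  have hb : C (t : ℂ) * (C d - T (-1)) ≠ 0 := by
    intro h
    have h' : C (t * d) * T 0 - C (t : ℂ) * T (-1) = 0 := by
      rw [← h, map_mul, T_zero]
      ring
    have := congrArg (fun f => f.coeff (-1)) h'
    simp [AddMonoidAlgebra.coeff_sub, LaurentPolynomial.coeff_C_mul_T, -map_mul, -T_zero] at this
  rw [map_zero, zero_mul, sub_zero]
  refine mul_ne_zero hb fun h => hb ?_
  rw [← laurentReflection_laurentReflection t (C (t : ℂ) * (C d - T (-1))), h, map_zero]

/-! ### The algebra by generators and relations -/

variable (r k₁ u₀ u₁ : ℂ)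

theorem HV.satisfiesHV : SatisfiesHV r k₁ u₀ u₁ (HV.gen r k₁ u₀ u₁ .v0) (HV.gen r k₁ u₀ u₁ .v1)
    (HV.gen r k₁ u₀ u₁ .cv0) (HV.gen r k₁ u₀ u₁ .cv1) where
  rel1 := by simpa [HV.gen] using RingQuot.mkAlgHom_rel ℂ (HVRel.rel1 (r := r) (k₁ := k₁)
    (u₀ := u₀) (u₁ := u₁))
  rel2 := by simpa [HV.gen] using RingQuot.mkAlgHom_rel ℂ (HVRel.rel2 (r := r) (k₁ := k₁)
    (u₀ := u₀) (u₁ := u₁))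
  rel3 := by simpa [HV.gen] using RingQuot.mkAlgHom_rel ℂ (HVRel.rel3 (r := r) (k₁ := k₁)
    (u₀ := u₀) (u₁ := u₁))
  rel4 := by simpa [HV.gen] using RingQuot.mkAlgHom_rel ℂ (HVRel.rel4 (r := r) (k₁ := k₁)
    (u₀ := u₀) (u₁ := u₁))
  rel5 := by simpa [HV.gen] using RingQuot.mkAlgHom_rel ℂ (HVRel.rel5 (r := r) (k₁ := k₁)
    (u₀ := u₀) (u₁ := u₁))
  rel6 := by simpa [HV.gen] using RingQuot.mkAlgHom_rel ℂ (HVRel.rel6 (r := r) (k₁ := k₁)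
    (u₀ := u₀) (u₁ := u₁))

theorem HV.adjoin_range_gen : Algebra.adjoin ℂ (Set.range (HV.gen r k₁ u₀ u₁)) = ⊤ := by
  have h := congrArg (Subalgebra.map (RingQuot.mkAlgHom ℂ (HVRel r k₁ u₀ u₁)))
    (FreeAlgebra.adjoin_range_ι (R := ℂ) (X := HVGen))
  rw [AlgHom.map_adjoin, ← Set.range_comp, Algebra.map_top,
    (AlgHom.range_eq_top _).2 (RingQuot.mkAlgHom_surjective ℂ _)] at h
  exact h

variable {r k₁ u₀ u₁}

theorem HV.adjoin_letters (hk₁ : k₁ ≠ 0) (hu₁ : u₁ ≠ 0) :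
    Algebra.adjoin ℂ {((HV.satisfiesHV r k₁ u₀ u₁).unit hk₁ hu₁ : HV r k₁ u₀ u₁),
      (↑((HV.satisfiesHV r k₁ u₀ u₁).unit hk₁ hu₁)⁻¹ : HV r k₁ u₀ u₁),
      HV.gen r k₁ u₀ u₁ .v1, -HV.gen r k₁ u₀ u₁ .v0} = ⊤ := by
  set h := HV.satisfiesHV r k₁ u₀ u₁
  set W := h.unit hk₁ hu₁ with hW
  set A := Algebra.adjoin ℂ {(W : HV r k₁ u₀ u₁), (↑W⁻¹ : HV r k₁ u₀ u₁),
      HV.gen r k₁ u₀ u₁ .v1, -HV.gen r k₁ u₀ u₁ .v0} with hA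
  have hWA : (W : HV r k₁ u₀ u₁) ∈ A := Algebra.subset_adjoin (by simp)
  have h1 : HV.gen r k₁ u₀ u₁ .v1 ∈ A := Algebra.subset_adjoin (by simp)
  have h0 : HV.gen r k₁ u₀ u₁ .v0 ∈ A := by
    rw [← neg_neg (HV.gen r k₁ u₀ u₁ .v0)]
    exact neg_mem (Algebra.subset_adjoin (by simp))
  rw [eq_top_iff, ← HV.adjoin_range_gen, Algebra.adjoin_le_iff]
  rintro _ ⟨g, rfl⟩
  cases g with
  | v0 => exact h0
  | v1 => exact h1
  | cv0 =>
    rw [eq_sub_of_add_eq h.rel5.symm]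
    exact sub_mem (A.smul_mem (A.mul_mem hWA h0) r) (A.algebraMap_mem _)
  | cv1 =>
    -- `V̌₁ = (V̌₁ V₁) V₁⁻¹`, and `V₁⁻¹ = V₁ - (k₁ - k₁⁻¹)`.
    have hcv : HV.gen r k₁ u₀ u₁ .cv1 = W * (HV.gen r k₁ u₀ u₁ .v1 - (k₁ - k₁⁻¹) • 1) := by
      have : HV.gen r k₁ u₀ u₁ .v1 * (HV.gen r k₁ u₀ u₁ .v1 - (k₁ - k₁⁻¹) • 1) = 1 := by
        rw [mul_sub, mul_self_of_hecke hk₁ h.rel2, mul_smul_comm, mul_one, map_one,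
          add_sub_cancel_left]
      rw [hW]
      change _ = HV.gen r k₁ u₀ u₁ .cv1 * HV.gen r k₁ u₀ u₁ .v1 * _
      rw [mul_assoc, this, mul_one]
    rw [hcv]
    exact A.mul_mem hWA (sub_mem h1 (A.smul_mem A.one_mem _))

/-- The homomorphism from `H_V` to an algebra containing a solution of the six relations. -/
noncomputable def HV.lift {V : HVGen → R}
    (h : SatisfiesHV r k₁ u₀ u₁ (V .v0) (V .v1) (V .cv0) (V .cv1)) :
    HV r k₁ u₀ u₁ →ₐ[ℂ] R :=
  RingQuot.liftAlgHom ℂ ⟨FreeAlgebra.lift ℂ V, by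
    rintro _ _ (_ | _ | _ | _ | _ | _)
    · simpa using h.rel1
    · simpa using h.rel2
    · simpa using h.rel3
    · simpa using h.rel4
    · simpa using h.rel5
    · simpa using h.rel6⟩

theorem HV.lift_gen {V : HVGen → R}
    (h : SatisfiesHV r k₁ u₀ u₁ (V .v0) (V .v1) (V .cv0) (V .cv1)) (g : HVGen) :
    HV.lift h (HV.gen r k₁ u₀ u₁ g) = V g := by
  simp [HV.lift, HV.gen]

/-- A homomorphism out of `H_V` is injective as soon as the image of `V̌₁ V₁` is transcendental. -/
theorem HV.injective_of_transcendental {q : ℂˣ} (hr : r ^ 2 = q)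
    (hq : ∀ m : ℕ, 0 < m → (q : ℂ) ^ m ≠ 1) (hk₁ : k₁ ≠ 0) (hu₁ : u₁ ≠ 0)
    (φ : HV r k₁ u₀ u₁ →ₐ[ℂ] R)
    (hφ : ∀ p : Polynomial ℂ,
      p.aeval (φ (HV.gen r k₁ u₀ u₁ .cv1) * φ (HV.gen r k₁ u₀ u₁ .v1)) = 0 → p = 0) :
    Function.Injective φ := by
  have h := HV.satisfiesHV r k₁ u₀ u₁
  refine injective_of_injective_comp_laurentEval (W := h.unit hk₁ hu₁) (q := q)
    (fun m hm h => hq m hm (by simpa using congrArg Units.val h)) φ ?_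
    (h.isDemazureLetter_V₁ hk₁ hu₁) (h.isDemazureLetter_neg_V₀ hk₁ hu₁ hr)
    (laurentReflection_sub_V₁ _ _) (laurentReflection_sub_V₀ _ _)
    (intertwiner_sq_V₁_ne_zero _ _) (intertwiner_sq_V₀_ne_zero _)
    (HV.adjoin_letters hk₁ hu₁)
  change Function.Injective (φ.comp (laurentEval (h.unit hk₁ hu₁)))
  refine (injective_iff_map_eq_zero _).2 fun f hf => ?_
  -- Multiplying by a power of `X` turns `f` into a polynomial.
  obtain ⟨n, p, hp⟩ := LaurentPolynomial.exists_T_pow f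
  have hp0 : (φ.comp (laurentEval (h.unit hk₁ hu₁))) (Polynomial.toLaurent p) = 0 := by
    rw [hp, map_mul, hf, zero_mul]
  have halg : (φ.comp (laurentEval (h.unit hk₁ hu₁))).comp Polynomial.toLaurentAlg =
      Polynomial.aeval (φ (HV.gen r k₁ u₀ u₁ .cv1) * φ (HV.gen r k₁ u₀ u₁ .v1)) := by
    ext
    simp [laurentEval_T_one]
    rw [← map_mul]
    rfl
  have : p = 0 := hφ p (by rw [← halg]; exact hp0)
  rw [this, map_zero] at hp
  exact (mul_eq_zero.1 hp.symm).resolve_right (isUnit_T _).ne_zero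

end ConfluentCherednik

/-! ### The six relations for the matrices -/


section Torus

open Complex

/-- The elements `E a b c` of an algebra multiply like the exponentials `e^{a S₁ + b S₂ + c S₃}`. -/
structure IsTorusExp {A : Type*} [Ring A] [Algebra ℂ A] (r u₀ : ℂ) (E : ℤ → ℤ → ℤ → A) : Prop where
  zero : E 0 0 0 = 1
  mul : ∀ a b c a' b' c', E a b c * E a' b' c' =
    r ^ (-((a * b' - b * a') + (b * c' - c * b') + (c * a' - a * c'))) •
      E (a + a') (b + b') (c + c')
  casimir : -(I • E (-1) (-1) (-1)) = algebraMap ℂ A u₀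

namespace IsTorusExp

variable {A : Type*} [Ring A] [Algebra ℂ A] {r k₁ u₀ u₁ : ℂ} {E : ℤ → ℤ → ℤ → A}

theorem casimir_inv (h : IsTorusExp r u₀ E) (hu₀ : u₀ ≠ 0) :
    algebraMap ℂ A u₀⁻¹ = I • E 1 1 1 := by
  have h2 : algebraMap ℂ A u₀ * (I • E 1 1 1) = 1 := by
    rw [← h.casimir, neg_mul, smul_mul_smul_comm, h.mul, I_mul_I]
    simp [h.zero]
  rw [← mul_one (algebraMap ℂ A u₀⁻¹), ← h2, ← mul_assoc, ← map_mul, inv_mul_cancel₀ hu₀, map_one,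
    one_mul]

/-- The four matrices satisfy the six relations. Substituting `u₀⁻¹ = i e^{S₁ + S₂ + S₃}` makes
every entry a linear combination of exponentials, and these are compared term by term. -/
theorem satisfiesHV (h : IsTorusExp r u₀ E) (hr : r ≠ 0) (hk₁ : k₁ ≠ 0) (hu₀ : u₀ ≠ 0)
    (hu₁ : u₁ ≠ 0) {s : A}
    (hs : s = E (-1) 0 0 * E 0 (-1) 0 + (k₁⁻¹ - k₁) • (E (-1) 0 0 * E 0 0 1)
      + (u₁⁻¹ - u₁) • (E 0 1 0 * E 0 0 1) + I • (E (-1) 0 0 * E 0 (-1) 0 * E 0 0 1)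
      + I • (E (-1) 0 0 * E 0 1 0 * E 0 0 1)) :
    SatisfiesHV r k₁ u₀ u₁
      (!![-1, 0; 1 + I • E 0 0 1, 0] : Matrix (Fin 2) (Fin 2) A)
      !![algebraMap ℂ A (k₁ - k₁⁻¹) - I • E 0 1 0,
          algebraMap ℂ A (k₁ - k₁⁻¹) - I • E 0 (-1) 0 - I • E 0 1 0;
        I • E 0 1 0, I • E 0 1 0]
      !![0, 0; r • s, -algebraMap ℂ A u₀⁻¹]
      !![0, -(I • E 1 0 0); I • E (-1) 0 0, algebraMap ℂ A (u₁ - u₁⁻¹)] where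
  rel1 := by
    rw [pow_two]
    ext i j
    fin_cases i <;> fin_cases j <;> simp
  rel2 := by
    rw [Matrix.algebraMap_eq_diagonal, Matrix.algebraMap_eq_diagonal]
    ext i j
    fin_cases i <;> fin_cases j <;> simp [Algebra.algebraMap_eq_smul_one, mul_add, sub_mul,
      mul_sub, smul_smul, h.mul, h.zero]
    all_goals match_scalars
    all_goals (field_simp <;> ring_nf <;> simp)
  rel3 := by
    rw [pow_two]
    ext i j
    fin_cases i <;> fin_cases j <;> simp [Algebra.algebraMap_eq_smul_one]
  rel4 := by
    rw [Matrix.algebraMap_eq_diagonal, Matrix.algebraMap_eq_diagonal]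
    ext i j
    fin_cases i <;> fin_cases j <;> simp [Algebra.algebraMap_eq_smul_one, mul_add, sub_mul,
      mul_sub, smul_smul, h.mul, h.zero]
    all_goals match_scalars
    all_goals (field_simp <;> ring_nf)
  rel5 := by
    rw [Matrix.algebraMap_eq_diagonal]
    ext i j
    fin_cases i <;> fin_cases j <;> simp [h.casimir_inv hu₀, hs, -map_inv₀]
    all_goals simp [Algebra.algebraMap_eq_smul_one, mul_add, add_mul, sub_mul, mul_sub, smul_smul,
      h.mul, mul_assoc]
    all_goals match_scalars
    all_goals (field_simp <;> ring_nf <;> simp)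
  rel6 := by
    ext i j
    fin_cases i <;> fin_cases j <;> simp [h.casimir_inv hu₀, hs, -map_inv₀]
    all_goals simp [Algebra.algebraMap_eq_smul_one, add_mul, sub_mul, mul_sub, smul_smul,
      h.mul, h.zero, mul_assoc]
    all_goals match_scalars
    all_goals (field_simp <;> ring_nf <;> simp)

end IsTorusExp

/-! ### A representation of the quantum torus -/

/-- The action of `e^S`, `S = m₁S₁ + m₂S₂ + m₃S₃`, on functions on `ℤ × ℤ`: a translation
by `(m₁ - m₃, m₂ - m₃)` composed with multiplication by a power of `r`; the Casimir element acts by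
a scalar. -/
noncomputable def torusShift (r u₀ : ℂ) (m : Fin 3 → ℤ) : Module.End ℂ (ℤ × ℤ → ℂ) where
  toFun f x := (I * u₀) ^ (-m 2) * r ^ (-((m 0 - m 2) * x.2 - (m 1 - m 2) * x.1)) *
    f (x.1 - (m 0 - m 2), x.2 - (m 1 - m 2))
  map_add' f g := by
    ext x
    simp [mul_add]
  map_smul' c f := by
    ext x
    simp only [Pi.smul_apply, smul_eq_mul, RingHom.id_apply]
    ring

/-- The representation of the quantum torus on functions on `ℤ × ℤ`. -/
noncomputable def torusRep {r u₀ : ℂ} (hr : r ≠ 0) (hu₀ : u₀ ≠ 0) :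
    QTorus r u₀ →ₐ[ℂ] Module.End ℂ (ℤ × ℤ → ℂ) :=
  RingQuot.liftAlgHom ℂ ⟨FreeAlgebra.lift ℂ (torusShift r u₀), by
    have hI : I * u₀ ≠ 0 := mul_ne_zero I_ne_zero hu₀
    rintro _ _ (_ | ⟨m, n⟩ | _)
    · ext f x
      simp [torusShift]
    · rw [map_mul, map_smul, FreeAlgebra.lift_ι_apply, FreeAlgebra.lift_ι_apply,
        FreeAlgebra.lift_ι_apply]
      ext1 f
      funext x
      simp only [torusShift, torusForm, Module.End.mul_apply, LinearMap.coe_mk, AddHom.coe_mk,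
        LinearMap.smul_apply, Pi.smul_apply, Pi.add_apply, smul_eq_mul]
      rw [show x.1 - (m 0 - m 2) - (n 0 - n 2) = x.1 - (m 0 + n 0 - (m 2 + n 2)) by ring,
        show x.2 - (m 1 - m 2) - (n 1 - n 2) = x.2 - (m 1 + n 1 - (m 2 + n 2)) by ring]
      have h1 : (I * u₀) ^ (-(m 2 + n 2)) = (I * u₀) ^ (-m 2) * (I * u₀) ^ (-n 2) := by
        rw [neg_add, zpow_add₀ hI]
      have h2 : r ^ (-((m 0 - m 2) * x.2 - (m 1 - m 2) * x.1)) *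
          r ^ (-((n 0 - n 2) * (x.2 - (m 1 - m 2)) - (n 1 - n 2) * (x.1 - (m 0 - m 2)))) =
          r ^ (-(m 0 * n 1 - m 1 * n 0 + (m 1 * n 2 - m 2 * n 1) + (m 2 * n 0 - m 0 * n 2))) *
          r ^ (-((m 0 + n 0 - (m 2 + n 2)) * x.2 - (m 1 + n 1 - (m 2 + n 2)) * x.1)) := by
        rw [← zpow_add₀ hr, ← zpow_add₀ hr]
        ring_nf
      rw [h1]
      linear_combination ((I * u₀) ^ (-m 2) * (I * u₀) ^ (-n 2) *
        f (x.1 - (m 0 + n 0 - (m 2 + n 2)), x.2 - (m 1 + n 1 - (m 2 + n 2)))) * h2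
    · rw [map_neg, map_smul, FreeAlgebra.lift_ι_apply, AlgHom.commutes]
      ext1 f
      funext x
      simp [torusShift, Algebra.algebraMap_eq_smul_one]
      rw [← mul_assoc, ← mul_assoc, I_mul_I]
      simp⟩

theorem torusRep_qexp {r u₀ : ℂ} (hr : r ≠ 0) (hu₀ : u₀ ≠ 0) (a b c : ℤ) :
    torusRep hr hu₀ (qexp r u₀ a b c) = torusShift r u₀ ![a, b, c] := by
  simp [torusRep, qexp]

theorem isTorusExp_qexp (r u₀ : ℂ) : IsTorusExp r u₀ (qexp r u₀) where
  zero := by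
    have := RingQuot.mkAlgHom_rel ℂ (TorusRel.zero (r := r) (u₀ := u₀))
    rw [map_one] at this
    rw [← this, qexp]
    congr 2
    ext i
    fin_cases i <;> rfl
  mul a b c a' b' c' := by
    have := RingQuot.mkAlgHom_rel ℂ (TorusRel.mul (r := r) (u₀ := u₀) ![a, b, c] ![a', b', c'])
    rw [map_mul, map_smul] at this
    rw [qexp, qexp, this, qexp]
    simp [torusForm]
  casimir := by
    simpa [qexp] using RingQuot.mkAlgHom_rel ℂ (TorusRel.casimir (r := r) (u₀ := u₀))

/-! ### Transcendence of the product `V̌₁ V₁` -/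

section Transcendence

variable {A : Type*} [Ring A] [Algebra ℂ A] {r k₁ u₀ u₁ : ℂ} {E : ℤ → ℤ → ℤ → A}

/-- The product of the images of `V̌₁` and `V₁` is transcendental. Functions on `ℤ × ℤ` are graded by
the weight `x₂ - 2 x₁` of the points. The lower entries of the product raise the weight by at most
`3`, the term `e^{-S₁} e^{S₂}` being the only one to attain this bound, and the upper entries lower
it. Hence the upper right entry of the `n`-th power carries the delta function at the origin
to weights below `3 n`, and the lower right entry carries it to weights at most `3 n`, with
a nonzero value at `(-n, n)`. -/
theorem eq_zero_of_aeval_mul_eq_zero (hr : r ≠ 0)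
    (ρ : A →ₐ[ℂ] Module.End ℂ (ℤ × ℤ → ℂ))
    (hρ : ∀ a b c, ρ (E a b c) = torusShift r u₀ ![a, b, c]) {κ μ : ℂ} {p : Polynomial ℂ}
    (hp : p.aeval ((!![0, -(I • E 1 0 0); I • E (-1) 0 0, algebraMap ℂ A μ] :
        Matrix (Fin 2) (Fin 2) A) *
      !![algebraMap ℂ A κ - I • E 0 1 0, algebraMap ℂ A κ - I • E 0 (-1) 0 - I • E 0 1 0;
        I • E 0 1 0, I • E 0 1 0]) = 0) : p = 0 := by
  set M := (!![0, -(I • E 1 0 0); I • E (-1) 0 0, algebraMap ℂ A μ] :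
        Matrix (Fin 2) (Fin 2) A) *
      !![algebraMap ℂ A κ - I • E 0 1 0, algebraMap ℂ A κ - I • E 0 (-1) 0 - I • E 0 1 0;
        I • E 0 1 0, I • E 0 1 0] with hM
  let δ : ℤ × ℤ → ℂ := Pi.single (0, 0) 1
  have h0 : ∀ (u v : ℤ × ℤ → ℂ) (x : ℤ × ℤ), ρ (M 0 0) u x + ρ (M 0 1) v x =
      (r ^ x.2)⁻¹ * r ^ (x.1 - 1) * (u (x.1 - 1, x.2 - 1) + v (x.1 - 1, x.2 - 1)) := by
    intro u v x
    rw [hM]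
    simp [hρ, torusShift]
    linear_combination -((r ^ x.2)⁻¹ * r ^ (x.1 - 1) *
      (u (x.1 - 1, x.2 - 1) + v (x.1 - 1, x.2 - 1))) * I_mul_I
  have h1 : ∀ (u v : ℤ × ℤ → ℂ) (x : ℤ × ℤ), ρ (M 1 0) u x + ρ (M 1 1) v x =
      I * r ^ x.2 * (κ * u (x.1 + 1, x.2) - I * (r ^ (x.1 + 1) * u (x.1 + 1, x.2 - 1)))
      + μ * I * r ^ x.1 * (u (x.1, x.2 - 1) + v (x.1, x.2 - 1))
      + I * r ^ x.2 * (κ * v (x.1 + 1, x.2) - I * ((r ^ (x.1 + 1))⁻¹ * v (x.1 + 1, x.2 + 1)))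
      + r ^ x.2 * r ^ (x.1 + 1) * v (x.1 + 1, x.2 - 1) := by
    intro u v x
    rw [hM]
    simp [hρ, torusShift]
    linear_combination -(r ^ x.2 * r ^ (x.1 + 1) * v (x.1 + 1, x.2 - 1)) * I_mul_I
  have hpow : ∀ (n : ℕ) (i : Fin 2) (x : ℤ × ℤ), ρ ((M ^ (n + 1)) i 1) δ x =
      ρ (M i 0) (ρ ((M ^ n) 0 1) δ) x + ρ (M i 1) (ρ ((M ^ n) 1 1) δ) x := by
    intro n i x
    rw [pow_succ', Matrix.mul_apply, Fin.sum_univ_two, map_add, map_mul, map_mul]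
    rfl
  have key : ∀ n : ℕ,
      (∀ x : ℤ × ℤ, 3 * (n : ℤ) ≤ x.2 - 2 * x.1 → ρ ((M ^ n) 0 1) δ x = 0) ∧
      (∀ x : ℤ × ℤ, 3 * (n : ℤ) < x.2 - 2 * x.1 → ρ ((M ^ n) 1 1) δ x = 0) ∧
      ρ ((M ^ n) 1 1) δ (-n, n) ≠ 0 := by
    intro n
    induction n with
    | zero =>
      refine ⟨fun x _ => by simp, fun x hx => ?_, by simp [δ]⟩
      have hx0 : x ≠ (0, 0) := by
        rintro rfl
        simp at hx
      simp [δ, hx0]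
    | succ n ih =>
      obtain ⟨ihu, ihv, ihne⟩ := ih
      push_cast
      refine ⟨fun x hx => ?_, fun x hx => ?_, ?_⟩
      · rw [hpow, h0, ihu _ (by dsimp only; omega), ihv _ (by dsimp only; omega)]
        simp
      · rw [hpow, h1, ihu _ (by dsimp only; omega), ihu _ (by dsimp only; omega),
          ihu _ (by dsimp only; omega), ihv _ (by dsimp only; omega),
          ihv _ (by dsimp only; omega), ihv _ (by dsimp only; omega),
          ihv _ (by dsimp only; omega)]
        simp
      · rw [hpow, h1, ihu _ (by dsimp only; omega), ihu _ (by dsimp only; omega),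
          ihu _ (by dsimp only; omega), ihv (_, _ - 1) (by dsimp only; omega),
          ihv (_, (n : ℤ) + 1) (by dsimp only; omega), ihv (_, _ + 1) (by dsimp only; omega)]
        simpa [hr, zpow_ne_zero] using ihne
  -- The leading coefficient of `p` is read off at the point `(-n, n)`, `n = deg p`.
  by_contra hp0
  have hsum := congrArg (fun N : Matrix (Fin 2) (Fin 2) A =>
    ρ (N 1 1) δ (-p.natDegree, p.natDegree)) hp
  simp only [Polynomial.aeval_eq_sum_range, Matrix.sum_apply, Matrix.smul_apply, map_sum, map_smul,
    LinearMap.sum_apply, Finset.sum_apply, LinearMap.smul_apply, Pi.smul_apply, Matrix.zero_apply,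
    map_zero, LinearMap.zero_apply, Pi.zero_apply, smul_eq_mul] at hsum
  rw [Finset.sum_range_succ, Finset.sum_eq_zero, zero_add] at hsum
  · exact (mul_ne_zero (Polynomial.leadingCoeff_ne_zero.2 hp0) (key p.natDegree).2.2) hsum
  · intro i hi
    have hi' := Finset.mem_range.1 hi
    rw [(key i).2.1 _ (by dsimp only; omega), mul_zero]

end Transcendence

end Torus

/-! ### Injectivity of the matrix homomorphism -/

theorem not_isUnit_of_right_column_zero {A : Type*} [Ring A] [Nontrivial A] (a b : A) :
    ¬ IsUnit (!![a, 0; b, 0] : Matrix (Fin 2) (Fin 2) A) := by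
  rintro ⟨u, hu⟩
  have := congrFun (congrFun u.inv_mul 1) 1
  rw [hu, Matrix.mul_apply, Fin.sum_univ_two] at this
  simp at this

theorem not_isUnit_of_upper_row_zero {A : Type*} [Ring A] [Nontrivial A] (a b : A) :
    ¬ IsUnit (!![0, 0; a, b] : Matrix (Fin 2) (Fin 2) A) := by
  rintro ⟨u, hu⟩
  have := congrFun (congrFun u.mul_inv 0) 0
  rw [hu, Matrix.mul_apply, Fin.sum_univ_two] at this
  simp at this

theorem mainTheorem2 (q r k₁ u₀ u₁ : ℂ) (hr : r ^ 2 = q) (hq : q ≠ 0)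
    (hq1 : ∀ m : ℕ, 0 < m → q ^ m ≠ 1) (hk₁ : k₁ ≠ 0) (hu₀ : u₀ ≠ 0) (hu₁ : u₁ ≠ 0) :
    SatisfiesHV r k₁ u₀ u₁
        (matV₀ r u₀) (matV₁ r k₁ u₀) (matCV₀ r k₁ u₀ u₁) (matCV₁ r u₀ u₁) ∧
      (¬ IsUnit (matV₀ r u₀) ∧ ¬ IsUnit (matCV₀ r k₁ u₀ u₁)) ∧
      ∃ φ : HV r k₁ u₀ u₁ →ₐ[ℂ] Matrix (Fin 2) (Fin 2) (QTorus r u₀),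
        φ (HV.gen r k₁ u₀ u₁ HVGen.v0) = matV₀ r u₀ ∧
        φ (HV.gen r k₁ u₀ u₁ HVGen.v1) = matV₁ r k₁ u₀ ∧
        φ (HV.gen r k₁ u₀ u₁ HVGen.cv0) = matCV₀ r k₁ u₀ u₁ ∧
        φ (HV.gen r k₁ u₀ u₁ HVGen.cv1) = matCV₁ r u₀ u₁ ∧
        Function.Injective φ := by
  have hr0 : r ≠ 0 := by
    rintro rfl
    exact hq (by rw [← hr]; simp)
  have hsat : SatisfiesHV r k₁ u₀ u₁
      (matV₀ r u₀) (matV₁ r k₁ u₀) (matCV₀ r k₁ u₀ u₁) (matCV₁ r u₀ u₁) :=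
    (isTorusExp_qexp r u₀).satisfiesHV hr0 hk₁ hu₀ hu₁ rfl
  have : Nontrivial (QTorus r u₀) := (torusRep hr0 hu₀).toRingHom.domain_nontrivial
  let V : HVGen → Matrix (Fin 2) (Fin 2) (QTorus r u₀)
    | .v0 => matV₀ r u₀
    | .v1 => matV₁ r k₁ u₀
    | .cv0 => matCV₀ r k₁ u₀ u₁
    | .cv1 => matCV₁ r u₀ u₁
  have hV : SatisfiesHV r k₁ u₀ u₁ (V .v0) (V .v1) (V .cv0) (V .cv1) := hsat
  refine ⟨hsat, ⟨not_isUnit_of_right_column_zero _ _, not_isUnit_of_upper_row_zero _ _⟩,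
    HV.lift hV, HV.lift_gen hV _, HV.lift_gen hV _, HV.lift_gen hV _, HV.lift_gen hV _,
    HV.injective_of_transcendental (q := Units.mk0 q hq) hr hq1 hk₁ hu₁ _ fun p hp => ?_⟩
  rw [HV.lift_gen, HV.lift_gen] at hp
  exact eq_zero_of_aeval_mul_eq_zero hr0 (torusRep hr0 hu₀) (torusRep_qexp hr0 hu₀) hp
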